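/- Let $\mathbb{F}_q$ be a finite field with $q$ elements, let $\alpha\in\mathbb{F}_q^{\times}$, and let $\mathcal{C}\subseteq\mathbb{F}_q^n$ be an $(\mathrm{Id},0,\alpha)$-cyclic code, i.e. a linear subspace such that $(\alpha c_{n-1},c_0,\dots,c_{n-2})\in\mathcal{C}$ whenever $(c_0,\dots,c_{n-1})\in\mathcal{C}$. Identify $(c_0,\dots,c_{n-1})$ with the class of $c_0+c_1x+\dots+c_{n-1}x^{n-1}$ in $\mathbb{F}_q[x]/\langle x^n-\alpha\rangle$. Suppose that $\mathcal{C}$ is the ideal $\langle g(x)\rangle$ generated by the class of a polynomial $g\in\mathbb{F}_q[x]$, that $x^n-\alpha=h(x)g(x)$ with $h\in\mathbb{F}_q[x]$, and that $\mathcal{C}$ has parameters $[n,k,d]_q$, i.e. dimension $k$ and minimum Hamming distance $d$ (the minimum of the Hamming distances between distinct codewords). If $g(x)$ divides $h(x)$ in $\mathbb{F}_q[x]$, then there exists a quantum code with parameters $[[n,2k-n,\ge d]]_q$. Here a quantum code with parameters $[[n,\kappa,\ge d]]_q$ is a $q^{\kappa}$-dimensional subspace $Q$ of the Hilbert space $(\mathbb{C}^q)^{\otimes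 n}$ with minimum distance at least $d$: for every linear operator $E$ on $(\mathbb{C}^q)^{\otimes n}$ that acts as the identity outside some set of fewer than $d$ tensor factors, there is a scalar $c_E\in\mathbb{C}$ with $\langle\varphi,E\psi\rangle=c_E\langle\varphi,\psi\rangle$ for all $\varphi,\psi\in Q$; if $\dim Q=1$, it is required in addition (the usual convention) that $\langle\psi,E\psi\rangle=0$ for all $\psi\in Q$ and all such $E$ with trace $0$. -/

import Mathlib

open Polynomial

section ClassicalCodes

/-- The matrix `M_α`: ones on the superdiagonal, `α` in the lower left corner, zeros elsewhere
(for `n = 1` it is the matrix `(α)`). -/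
def shiftMatrix {F : Type*} [Field F] (n : ℕ) (α : F) : Matrix (Fin n) (Fin n) F :=
  Matrix.of fun i j =>
    if (i : ℕ) + 1 = (j : ℕ) then 1
    else if (i : ℕ) + 1 = n ∧ (j : ℕ) = 0 then α
    else 0

/-- The pseudo-linear transformation `T_{θ,δ,M}(r) = θ(r) M + δ(r)` of `F ^ n`, where `θ` and `δ`
act coordinatewise and vectors are row vectors. -/
def pseudoLinear {F : Type*} [Field F] {n : ℕ} (θ : F ≃+* F) (δ : F →+ F)
    (M : Matrix (Fin n) (Fin n) F) (r : Fin n → F) : Fin n → F :=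
  Matrix.vecMul (fun i => θ (r i)) M + fun i => δ (r i)

/-- `(θ, δ, α)`-cyclic codes (for an automorphism `θ` and a `θ`-derivation `δ`): subspaces of
`F ^ n` that are stable under `T_{θ,δ,M_α}`. -/
def IsSkewCyclicCode {F : Type*} [Field F] {n : ℕ} (θ : F ≃+* F) (δ : F →+ F) (α : Fˣ)
    (𝒞 : Submodule F (Fin n → F)) : Prop :=
  ∀ c ∈ 𝒞, pseudoLinear θ δ (shiftMatrix n (α : F)) c ∈ 𝒞

/-- The polynomial `c(x) = c₀ + c₁ x + ⋯ + c_{n-1} x ^ (n-1)` of a word `c`. -/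
noncomputable def codePoly {F : Type*} [Field F] {n : ℕ} (c : Fin n → F) : F[X] :=
  ∑ i : Fin n, C (c i) * X ^ (i : ℕ)

/-- `𝒞 = ⟨g⟩`: under `c ↦ c(x)`, the code `𝒞` is the ideal generated by the class of `g` in
`F[x] / ⟨x ^ n - α⟩`. -/
def IsGeneratedBy {F : Type*} [Field F] {n : ℕ} (α : Fˣ)
    (𝒞 : Submodule F (Fin n → F)) (g : F[X]) : Prop :=
  ∀ c : Fin n → F, c ∈ 𝒞 ↔
    Ideal.Quotient.mk (Ideal.span {(X ^ n - C (α : F) : F[X])}) (codePoly c) ∈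
      Ideal.span {Ideal.Quotient.mk (Ideal.span {(X ^ n - C (α : F) : F[X])}) g}

/-- `𝒞` has parameters `[n, k, d]`: its dimension is `k`, and `d` is the minimum of the Hamming
distances between two distinct codewords. -/
structure HasCodeParameters {F : Type*} [Field F] [DecidableEq F] {n : ℕ}
    (𝒞 : Submodule F (Fin n → F)) (k d : ℕ) : Prop where
  dim_eq : Module.finrank F 𝒞 = k
  isLeast_dist :
    IsLeast {w : ℕ | ∃ c ∈ 𝒞, ∃ c' ∈ 𝒞, c ≠ c' ∧ hammingDist c c' = w} d

end ClassicalCodes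

section QuantumCodes

/-- The Hilbert space `(ℂ^q)^{⊗ n}`, where the standard basis of `ℂ^q` is labelled by the elements
of an alphabet `A` with `q` letters: the orthonormal basis of product states is labelled by the
words in `A ^ n`. -/
abbrev QuditSpace (A : Type*) [Fintype A] (n : ℕ) : Type _ :=
  EuclideanSpace ℂ (Fin n → A)

/-- The operator `M ⊗ 1` on `(ℂ^q)^{⊗ n}` that acts as `M` on the tensor factors in `S` and as the
identity on the others. -/
noncomputable def localOperator {A : Type*} [Fintype A] [DecidableEq A] {n : ℕ}
    (S : Finset (Fin n)) (M : Matrix (S → A) (S → A) ℂ) :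
    QuditSpace A n →ₗ[ℂ] QuditSpace A n :=
  Matrix.toEuclideanLin (Matrix.of fun x y : Fin n → A =>
    if ∀ i, i ∉ S → x i = y i then M (fun i => x i) (fun i => y i) else 0)

/-- The quantum code `Q` has minimum distance at least `d`: every error that acts on fewer than `d`
of the `n` tensor factors is detectable, that is, `P E P = c P` for a scalar `c`, where `P` is the
orthogonal projection onto `Q`. For a one-dimensional code detectability is void, and the usual
convention applies that the code be pure: a traceless operator on fewer than `d` tensor factors
has expectation zero. -/
structure HasQuantumDistanceGE {A : Type*} [Fintype A] [DecidableEq A] {n : ℕ}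
    (Q : Submodule ℂ (QuditSpace A n)) (d : ℕ) : Prop where
  detects : ∀ (S : Finset (Fin n)), S.card < d → ∀ M : Matrix (S → A) (S → A) ℂ,
    ∃ c : ℂ, ∀ φ ∈ Q, ∀ ψ ∈ Q,
      inner ℂ φ (localOperator S M ψ) = c * inner ℂ φ ψ
  pure_of_dim_one : Module.finrank ℂ Q = 1 →
    ∀ (S : Finset (Fin n)), S.card < d → ∀ M : Matrix (S → A) (S → A) ℂ,
      M.trace = 0 → ∀ ψ ∈ Q, inner ℂ ψ (localOperator S M ψ) = 0

/-- `Q` is a quantum code with parameters `[[n, κ, ≥ d]]_q`, where `q` is the size of the alphabet: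
a subspace of `(ℂ^q)^{⊗ n}` of dimension `q ^ κ` whose minimum distance is at least `d`. The
exponent is an integer, so that `κ < 0` is impossible for `q ≥ 2`. -/
structure HasQuantumParametersGE {A : Type*} [Fintype A] [DecidableEq A] {n : ℕ}
    (Q : Submodule ℂ (QuditSpace A n)) (κ : ℤ) (d : ℕ) : Prop where
  dim_eq : (Module.finrank ℂ Q : ℝ) = (Fintype.card A : ℝ) ^ κ
  dist_ge : HasQuantumDistanceGE Q d

end QuantumCodes

/-! This is a CSS construction, with the Euclidean form replaced by `∑ aᵢ b_{n-1-i}`, the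
coefficient of `x^(n-1)` in `a(x) b(x)`. That coefficient survives reduction modulo `x^n - α`, so
the orthogonal space `D` of `𝒞` consists of words with `x^n - α ∣ g y`, that is `h ∣ y`. Hence `g ∣
h` gives `D ≤ 𝒞`, for every `α`.

The coset states of `𝒞 / D` span a space of dimension `q^(k-(n-k))`. Let `S` have fewer than `d`
positions. No nonzero word of `𝒞` lives on `S`, which handles shift errors; the same holds for the
reversal of `S`, so by duality `D` restricts onto `F ^ S`, which handles phase errors. -/

/-! ### The reversed dot product. -/

section ReversalForm

variable {F : Type*} [Field F] {n : ℕ}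

/-- The bilinear form `∑ aᵢ b_{n-1-i}` on `F ^ n`. -/
def reversalForm (F : Type*) [Field F] (n : ℕ) : LinearMap.BilinForm F (Fin n → F) :=
  LinearMap.mk₂ F (fun a b => ∑ i, a i * b i.rev)
    (fun a a' b => by simp [add_mul, Finset.sum_add_distrib])
    (fun c a b => by simp [Finset.mul_sum, mul_assoc])
    (fun a b b' => by simp [mul_add, Finset.sum_add_distrib])
    (fun c a b => by simp [Finset.mul_sum, mul_left_comm])

theorem reversalForm_apply (a b : Fin n → F) :
    reversalForm F n a b = ∑ i, a i * b i.rev := rfl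

theorem reversalForm_isSymm : (reversalForm F n).IsSymm := by
  refine ⟨fun a b => ?_⟩
  simp only [reversalForm_apply]
  rw [← Equiv.sum_comp Fin.revPerm]
  simp [mul_comm]

theorem reversalForm_nondegenerate : (reversalForm F n).Nondegenerate := by
  classical
  have hrefl : LinearMap.IsRefl (reversalForm F n) := fun a b =>
    LinearMap.BilinForm.IsSymm.isRefl reversalForm_isSymm a b
  refine hrefl.nondegenerate_iff_separatingLeft.2 fun a ha => ?_
  funext i
  simpa [reversalForm_apply, Pi.single_apply, Fin.rev_eq_iff] using ha (Pi.single i.rev 1)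

end ReversalForm

/-! ### Constacyclic codes as ideals, and their orthogonal spaces. -/

section ConstacyclicCodes

variable {F : Type*} [Field F] {n : ℕ}

theorem codePoly_coeff (c : Fin n → F) (j : ℕ) :
    (codePoly c).coeff j = if hj : j < n then c ⟨j, hj⟩ else 0 := by
  simp only [codePoly, finsetSum_coeff, coeff_C_mul, coeff_X_pow, mul_ite, mul_one, mul_zero]
  split_ifs with hj
  · rw [Finset.sum_eq_single ⟨j, hj⟩]
    · simp
    · intro b _ hb
      rw [if_neg]
      rintro rfl
      exact hb rfl
    · simp
  · exact Finset.sum_eq_zero fun i _ => if_neg fun e => hj (e.trans_lt i.2)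

theorem exists_codePoly_eq {p : F[X]} (hp : p.degree < n) : ∃ c : Fin n → F, codePoly c = p := by
  refine ⟨fun i => p.coeff i, ?_⟩
  ext j
  rw [codePoly_coeff]
  split_ifs with hj
  · rfl
  · exact ((degree_lt_iff_coeff_zero _ _).1 hp j (by omega)).symm

theorem IsGeneratedBy.mem_iff_dvd {α : Fˣ} {𝒞 : Submodule F (Fin n → F)} {g : F[X]}
    (hgen : IsGeneratedBy α 𝒞 g) (hg : g ∣ X ^ n - C (α : F)) (c : Fin n → F) :
    c ∈ 𝒞 ↔ g ∣ codePoly c := by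
  rw [hgen c, Ideal.mem_span_singleton]
  refine ⟨?_, fun hc => map_dvd _ hc⟩
  rintro ⟨r, hr⟩
  obtain ⟨r, rfl⟩ := Ideal.Quotient.mk_surjective r
  rw [← map_mul, Ideal.Quotient.eq, Ideal.mem_span_singleton] at hr
  have := (hg.trans hr).add (dvd_mul_right g r)
  rwa [sub_add_cancel] at this

theorem reversalForm_eq_coeff_mul (hn : 0 < n) (a b : Fin n → F) :
    reversalForm F n a b = (codePoly a * codePoly b).coeff (n - 1) := by
  rw [coeff_mul, Finset.Nat.sum_antidiagonal_eq_sum_range_succ_mk, reversalForm_apply,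
    Nat.succ_eq_add_one, Nat.sub_add_cancel hn, ← Fin.sum_univ_eq_sum_range
      (fun i => (codePoly a).coeff i * (codePoly b).coeff (n - 1 - i))]
  refine Finset.sum_congr rfl fun i _ => ?_
  rw [codePoly_coeff, codePoly_coeff, dif_pos i.2, dif_pos (by omega)]
  congr 2
  ext
  simp [Fin.val_rev]
  omega

/-- The coefficient of `X ^ (n-1)` in a polynomial of degree less than `2n - 1` is
unaffected by reduction modulo `X ^ n - α`. -/
theorem coeff_modByMonic_X_pow_sub_C (hn : 0 < n) (α : F) {p : F[X]}
    (hp : p.degree < (2 * n - 1 : ℕ)) :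
    (p %ₘ (X ^ n - C α)).coeff (n - 1) = p.coeff (n - 1) := by
  have hm : (X ^ n - C α).Monic := monic_X_pow_sub_C α hn.ne'
  -- The quotient has degree at most `n - 2`, so its multiple by `α` stays below degree `n - 1`.
  have hq : (p /ₘ (X ^ n - C α)).coeff (n - 1) = 0 := by
    by_cases h0 : p.degree < (X ^ n - C α).degree
    · rw [(divByMonic_eq_zero_iff hm).2 h0, coeff_zero]
    have hp0 : p ≠ 0 := by
      rintro rfl
      exact h0 (by simp [degree_X_pow_sub_C hn])
    rw [degree_X_pow_sub_C hn, ← natDegree_lt_iff_degree_lt hp0] at h0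
    rw [← natDegree_lt_iff_degree_lt hp0] at hp
    apply coeff_eq_zero_of_natDegree_lt
    rw [natDegree_divByMonic _ hm, natDegree_X_pow_sub_C]
    omega
  rw [modByMonic_eq_sub_mul_div, coeff_sub, sub_mul, coeff_sub, coeff_C_mul, hq,
    coeff_X_pow_mul', if_neg (by omega)]
  simp

/-- A nonzero remainder `r`, multiplied by `X ^ (n - 1 - deg r)`, needs no further reduction and has
its leading coefficient in degree `n - 1`. -/
theorem dvd_mul_of_forall_coeff_modByMonic (hn : 0 < n) (α : F) {p : F[X]}
    (hp : ∀ j, ((X ^ j * p) %ₘ (X ^ n - C α)).coeff (n - 1) = 0) : X ^ n - C α ∣ p := by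
  have hm : (X ^ n - C α).Monic := monic_X_pow_sub_C α hn.ne'
  rw [← modByMonic_eq_zero_iff_dvd hm]
  by_contra hr
  set r := p %ₘ (X ^ n - C α) with hr_def
  have hdeg : r.natDegree < n := by
    rw [natDegree_lt_iff_degree_lt hr, ← degree_X_pow_sub_C hn α]
    exact degree_modByMonic_lt _ hm
  have h1 : (X ^ (n - 1 - r.natDegree) * p) %ₘ (X ^ n - C α) = X ^ (n - 1 - r.natDegree) * r := by
    rw [← (modByMonic_eq_self_iff hm (p := X ^ (n - 1 - r.natDegree) * r)).2]
    · apply modByMonic_eq_of_dvd_sub hm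
      rw [← mul_sub]
      refine Dvd.dvd.mul_left ?_ _
      rw [hr_def, modByMonic_eq_sub_mul_div, sub_sub_cancel]
      exact dvd_mul_right _ _
    · rw [degree_mul, degree_X_pow, degree_eq_natDegree hr, degree_X_pow_sub_C hn]
      norm_cast
      omega
  have h2 := hp (n - 1 - r.natDegree)
  rw [h1, coeff_X_pow_mul', if_pos (by omega),
    show n - 1 - (n - 1 - r.natDegree) = r.natDegree by omega] at h2
  exact hr (leadingCoeff_eq_zero.1 h2)

theorem IsGeneratedBy.orthogonal_reversalForm_le {α : Fˣ} {𝒞 : Submodule F (Fin n → F)}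
    {g h : F[X]} (hn : 0 < n) (hgen : IsGeneratedBy α 𝒞 g) (hfactor : X ^ n - C (α : F) = h * g)
    (hdvd : g ∣ h) : (reversalForm F n).orthogonal 𝒞 ≤ 𝒞 := by
  have hm : (X ^ n - C (α : F)).Monic := monic_X_pow_sub_C _ hn.ne'
  have hgf : g ∣ X ^ n - C (α : F) := hfactor ▸ dvd_mul_left g h
  have hg : g ≠ 0 := by
    rintro rfl
    exact hm.ne_zero (by rw [hfactor, mul_zero])
  intro y hy
  rw [hgen.mem_iff_dvd hgf]
  -- It suffices that `h ∣ y`, equivalently `x^n - α = h g ∣ y g`; this is tested against the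
  -- codewords `X ^ j * g` reduced modulo `x^n - α`.
  refine hdvd.trans ((mul_dvd_mul_iff_right hg).1 (hfactor ▸
    dvd_mul_of_forall_coeff_modByMonic hn (α : F) fun j => ?_))
  obtain ⟨c, hc⟩ := exists_codePoly_eq (n := n) (p := (X ^ j * g) %ₘ (X ^ n - C (α : F)))
    ((degree_modByMonic_lt _ hm).trans_eq (degree_X_pow_sub_C hn _))
  have hcC : c ∈ 𝒞 := by
    rw [hgen.mem_iff_dvd hgf, hc, modByMonic_eq_sub_mul_div]
    exact dvd_sub (dvd_mul_left _ _) (hgf.mul_right _)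
  have h0 : reversalForm F n c y = 0 := hy c hcC
  rw [reversalForm_eq_coeff_mul hn, ← coeff_modByMonic_X_pow_sub_C hn (α : F), hc] at h0
  · rw [← h0]
    congr 1
    apply modByMonic_eq_of_dvd_sub hm
    rw [modByMonic_eq_sub_mul_div]
    exact ⟨((X ^ j * g) /ₘ (X ^ n - C (α : F))) * codePoly y, by ring⟩
  · rw [degree_lt_iff_coeff_zero]
    intro m hm
    rw [coeff_mul]
    refine Finset.sum_eq_zero fun x hx => ?_
    rw [Finset.HasAntidiagonal.mem_antidiagonal] at hx
    rw [codePoly_coeff, codePoly_coeff]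
    by_cases h1 : x.1 < n
    · rw [dif_neg (show ¬x.2 < n by omega), mul_zero]
    · rw [dif_neg h1, zero_mul]

end ConstacyclicCodes

/-! ### Coset states: dimension and error detection. -/

section CSSCodes

variable {F : Type*} [Field F] [Fintype F] {n : ℕ}

/-- The span of the coset states `∑_{y ∈ D} |c + y⟩` with `c ∈ 𝒞`: the vectors that are supported
on `𝒞` and invariant under translation by `D`. -/
def cosetCode (𝒞 D : Submodule F (Fin n → F)) : Submodule ℂ (QuditSpace F n) where
  carrier := {ψ | (∀ x, x ∉ 𝒞 → ψ x = 0) ∧ ∀ x, ∀ y ∈ D, ψ (x + y) = ψ x}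
  add_mem' := fun {a b} ha hb => ⟨fun x hx => by simp [ha.1 x hx, hb.1 x hx],
    fun x y hy => by simp [ha.2 x y hy, hb.2 x y hy]⟩
  zero_mem' := by simp
  smul_mem' := fun c a ha => ⟨fun x hx => by simp [ha.1 x hx],
    fun x y hy => by simp [ha.2 x y hy]⟩

open Classical in
/-- Coset codes are spaces of functions on `𝒞 ⧸ D`. -/
noncomputable def cosetCodeEquiv {𝒞 D : Submodule F (Fin n → F)} (hD : D ≤ 𝒞) :
    (𝒞 ⧸ D.comap 𝒞.subtype → ℂ) ≃ₗ[ℂ] cosetCode 𝒞 D where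
  toFun f := ⟨WithLp.toLp 2 fun x =>
      if hx : x ∈ 𝒞 then f (Submodule.Quotient.mk ⟨x, hx⟩) else 0, by
    refine ⟨fun x hx => by simp [hx], fun x y hy => ?_⟩
    have hiff : x + y ∈ 𝒞 ↔ x ∈ 𝒞 := 𝒞.add_mem_iff_left (hD hy)
    by_cases hx : x ∈ 𝒞
    · simp only [hx, hiff.2 hx, dif_pos]
      congr 1
      rw [Submodule.Quotient.eq]
      simpa using hy
    · simp [hx, hiff]⟩
  map_add' f f' := by
    ext x
    by_cases hx : x ∈ 𝒞 <;> simp [hx]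
  map_smul' c f := by
    ext x
    by_cases hx : x ∈ 𝒞 <;> simp [hx]
  invFun ψ := fun u => Quotient.liftOn' u (fun x => ψ.1 x.1) fun a b hab => by
    rw [Submodule.quotientRel_def] at hab
    have := ψ.2.2 b.1 (a.1 - b.1) hab
    rwa [add_sub_cancel] at this
  left_inv f := by
    funext u
    induction u using Submodule.Quotient.induction_on with
    | H x => exact dif_pos x.2
  right_inv ψ := by
    ext x
    by_cases hx : x ∈ 𝒞
    · exact dif_pos hx
    · exact (dif_neg hx).trans (ψ.2.1 x hx).symm

theorem finrank_cosetCode {𝒞 D : Submodule F (Fin n → F)} (hD : D ≤ 𝒞) :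
    Module.finrank ℂ (cosetCode 𝒞 D) =
      Fintype.card F ^ (Module.finrank F 𝒞 - Module.finrank F D) := by
  classical
  have h1 := Submodule.finrank_quotient_add_finrank (D.comap 𝒞.subtype)
  rw [(Submodule.comapSubtypeEquivOfLe hD).finrank_eq] at h1
  have : Fintype (𝒞 ⧸ D.comap 𝒞.subtype) := Fintype.ofFinite _
  rw [← (cosetCodeEquiv hD).finrank_eq, Module.finrank_fintype_fun_eq_card,
    Module.card_eq_pow_finrank (K := F), ← h1, Nat.add_sub_cancel]

theorem inner_localOperator {A : Type*} [Fintype A] [DecidableEq A] (S : Finset (Fin n)) (M : Matrix (S → A) (S → A) ℂ)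
    (φ ψ : QuditSpace A n) :
    inner ℂ φ (localOperator S M ψ) = ∑ x, ∑ y, if ∀ i, i ∉ S → x i = y i then
      star (φ x) * ψ y * M (fun i => x i) (fun i => y i) else 0 := by
  simp only [localOperator, PiLp.inner_apply, Matrix.toLpLin_apply, Matrix.mulVec,
    dotProduct, Matrix.of_apply, RCLike.inner_apply, Finset.sum_mul, ite_mul, zero_mul]
  refine Finset.sum_congr rfl fun x _ => Finset.sum_congr rfl fun y _ => ?_
  split_ifs
  · simp only [RCLike.star_def]
    ring
  · rfl

/-- A function that is invariant under a subspace `D` restricting onto `F ^ S` is uncorrelated with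
every function of the coordinates in `S`. -/
theorem sum_mul_restrict_of_invariant (D : Submodule F (Fin n → F)) (S : Finset (Fin n))
    (hsurj : ∀ t : S → F, ∃ y ∈ D, ∀ i : S, y i = t i) (f : (Fin n → F) → ℂ)
    (hf : ∀ x, ∀ y ∈ D, f (x + y) = f x) (m : (S → F) → ℂ) :
    (Fintype.card (S → F) : ℂ) * ∑ x, f x * m (fun i => x i) = (∑ t, m t) * ∑ x, f x := by
  -- Translating by an element of `D` that restricts to `t` fixes `f` and shifts the argument of
  -- `m`; summing over all `t` then averages `m`.
  have key (t : S → F) : ∑ x, f x * m (fun i => x i) = ∑ x, f x * m (fun i => x i + t i) := by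
    obtain ⟨y, hy, hyt⟩ := hsurj t
    rw [← Equiv.sum_comp (Equiv.addRight y)]
    refine Finset.sum_congr rfl fun x _ => ?_
    rw [Equiv.coe_addRight, hf x y hy]
    congr 2
    funext i
    simp [hyt]
  calc (Fintype.card (S → F) : ℂ) * ∑ x, f x * m (fun i => x i)
      = ∑ t : S → F, ∑ x, f x * m (fun i => x i + t i) := by
        rw [← Finset.sum_congr rfl fun t _ => key t]
        simp
    _ = ∑ x, f x * ∑ t : S → F, m (fun i => x i + t i) := by
        rw [Finset.sum_comm]
        simp [Finset.mul_sum]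
    _ = ∑ x, f x * ∑ t, m t :=
        Finset.sum_congr rfl fun x _ => by
          rw [← Equiv.sum_comp (Equiv.addLeft fun i : S => x i) m]
          rfl
    _ = (∑ t, m t) * ∑ x, f x := by rw [← Finset.sum_mul, mul_comm]

/-- Off-diagonal entries of `M` would link distinct codewords that agree outside `S`, excluded by
`hS`. On the diagonal, `star φ * ψ` is `D`-invariant, so only the mean of the diagonal of `M`
matters. This scalar vanishes for traceless `M`, which also gives purity. -/
theorem inner_localOperator_cosetCode [DecidableEq F] {𝒞 D : Submodule F (Fin n → F)} (S : Finset (Fin n))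
    (hS : ∀ c ∈ 𝒞, (∀ i, i ∉ S → c i = 0) → c = 0)
    (hsurj : ∀ t : S → F, ∃ y ∈ D, ∀ i : S, y i = t i) (M : Matrix (S → F) (S → F) ℂ)
    {φ ψ : QuditSpace F n} (hφ : φ ∈ cosetCode 𝒞 D) (hψ : ψ ∈ cosetCode 𝒞 D) :
    inner ℂ φ (localOperator S M ψ) = M.trace / Fintype.card (S → F) * inner ℂ φ ψ := by
  have h1 : inner ℂ φ (localOperator S M ψ) =
      ∑ x, star (φ x) * ψ x * M.diag (fun i => x i) := by
    rw [inner_localOperator]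
    refine Finset.sum_congr rfl fun x _ => ?_
    rw [Finset.sum_eq_single x]
    · simp
    · intro y _ hyx
      rw [ite_eq_right_iff]
      intro hxy
      by_cases hx : x ∈ 𝒞
      · by_cases hy : y ∈ 𝒞
        · refine absurd (sub_eq_zero.1 (hS _ (𝒞.sub_mem hy hx) fun i hi => ?_)) hyx
          simp [hxy i hi]
        · simp [hψ.1 y hy]
      · simp [hφ.1 x hx]
    · simp
  have h2 : inner ℂ φ ψ = ∑ x, star (φ x) * ψ x := by
    simp [PiLp.inner_apply, mul_comm]
  have h3 := sum_mul_restrict_of_invariant D S hsurj (fun x => star (φ x) * ψ x)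
    (fun x y hy => by simp only [hφ.2 x y hy, hψ.2 x y hy]) M.diag
  have h4 : (Fintype.card (S → F) : ℂ) ≠ 0 := Nat.cast_ne_zero.2 Fintype.card_ne_zero
  rw [h1, h2, div_mul_eq_mul_div, eq_div_iff h4, mul_comm, h3]
  rfl

theorem hasQuantumDistanceGE_cosetCode [DecidableEq F] {𝒞 D : Submodule F (Fin n → F)} {d : ℕ}
    (hS : ∀ S : Finset (Fin n), S.card < d → ∀ c ∈ 𝒞, (∀ i, i ∉ S → c i = 0) → c = 0)
    (hsurj : ∀ S : Finset (Fin n), S.card < d → ∀ t : S → F, ∃ y ∈ D, ∀ i : S, y i = t i) :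
    HasQuantumDistanceGE (cosetCode 𝒞 D) d where
  detects S hd M := ⟨_, fun _ hφ _ hψ =>
    inner_localOperator_cosetCode S (hS S hd) (hsurj S hd) M hφ hψ⟩
  pure_of_dim_one _ S hd M hM ψ hψ := by
    rw [inner_localOperator_cosetCode S (hS S hd) (hsurj S hd) M hψ hψ, hM, zero_div, zero_mul]

end CSSCodes

/-! ### Consequences of the classical minimum distance. -/

section Distance

variable {F : Type*} [Field F] {n : ℕ}

theorem HasCodeParameters.eq_zero_of_support_subset [DecidableEq F]
    {𝒞 : Submodule F (Fin n → F)} {k d : ℕ}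
    (hparam : HasCodeParameters 𝒞 k d) (S : Finset (Fin n)) (hS : S.card < d) (c : Fin n → F)
    (hc : c ∈ 𝒞) (hcS : ∀ i, i ∉ S → c i = 0) : c = 0 := by
  by_contra h0
  have h1 : d ≤ hammingDist c 0 := hparam.isLeast_dist.2 ⟨c, hc, 0, 𝒞.zero_mem, h0, rfl⟩
  rw [hammingDist_zero_right] at h1
  refine absurd (h1.trans (Finset.card_le_card fun i hi => ?_)) hS.not_ge
  by_contra hiS
  exact (Finset.mem_filter.1 hi).2 (hcS i hiS)

/-- If restriction were not onto, a nonzero functional on `F ^ S` would kill its image. Pulled back,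
it is pairing with a word `v` orthogonal to `D`, so `v ∈ 𝒞` by double orthogonality, and `hS` forces
`v = 0`. -/
theorem exists_mem_orthogonal_reversalForm_restrict_eq {𝒞 : Submodule F (Fin n → F)}
    (S : Finset (Fin n)) (hS : ∀ c ∈ 𝒞, (∀ i, i.rev ∉ S → c i = 0) → c = 0) (t : S → F) :
    ∃ y ∈ (reversalForm F n).orthogonal 𝒞, ∀ i : S, y i = t i := by
  classical
  set D := (reversalForm F n).orthogonal 𝒞
  let res : (Fin n → F) →ₗ[F] (S → F) := LinearMap.funLeft F F (fun i : S => (i : Fin n))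
  suffices h : D.map res = ⊤ by
    obtain ⟨y, hy, hyt⟩ := (h ▸ Submodule.mem_top : t ∈ D.map res)
    exact ⟨y, hy, fun i => congrFun hyt i⟩
  by_contra h
  obtain ⟨f, hf0, hf⟩ := Submodule.exists_le_ker_of_lt_top _ (lt_top_iff_ne_top.2 h)
  -- The form pairs position `i` with `i.rev`, so `v` lives on the reversal of `S`.
  let v : Fin n → F := fun i => if hi : i.rev ∈ S then f (Pi.single ⟨i.rev, hi⟩ 1) else 0
  have hv (y : Fin n → F) : reversalForm F n v y = f (res y) := by
    rw [LinearMap.pi_apply_eq_sum_univ f, reversalForm_apply, ← Equiv.sum_comp Fin.revPerm,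
      ← Finset.sum_subset (Finset.subset_univ S), ← Finset.sum_coe_sort S]
    · refine Finset.sum_congr rfl fun i _ => ?_
      have : (Pi.single i 1 : S → F) = fun j => if i = j then 1 else 0 := by
        funext j
        simp [Pi.single_apply, eq_comm]
      simp [v, res, LinearMap.funLeft_apply, mul_comm, this]
    · intro i _ hi
      simp [v, hi]
  have hvC : v ∈ 𝒞 := by
    rw [← LinearMap.BilinForm.orthogonal_orthogonal reversalForm_nondegenerate
      reversalForm_isSymm.isRefl 𝒞]
    intro y hy
    exact reversalForm_isSymm.isRefl _ _ ((hv y).trans (hf ⟨y, hy, rfl⟩))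
  have hv0 : v = 0 := hS v hvC fun i hi => dif_neg hi
  refine hf0 (LinearMap.ext fun s => ?_)
  obtain ⟨y, rfl⟩ := LinearMap.funLeft_surjective_of_injective F F _
    (Subtype.val_injective (p := (· ∈ S))) s
  rw [← show reversalForm F n v y = _ from hv y, hv0]
  simp

end Distance

theorem mainTheorem7 {F : Type*} [Field F] [Fintype F] [DecidableEq F]
    (n k d : ℕ) (α : Fˣ) (𝒞 : Submodule F (Fin n → F)) (g h : F[X])
    (hcyclic : IsSkewCyclicCode (RingEquiv.refl F) (0 : F →+ F) α 𝒞)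
    (hgen : IsGeneratedBy α 𝒞 g)
    (hparam : HasCodeParameters 𝒞 k d)
    (hfactor : X ^ n - C (α : F) = h * g)
    (hdvd : g ∣ h) :
    ∃ Q : Submodule ℂ (QuditSpace F n),
      HasQuantumParametersGE Q (2 * (k : ℤ) - (n : ℤ)) d := by
  -- A minimum distance presupposes two distinct codewords.
  have hn : 0 < n := by
    obtain ⟨c, -, c', -, hne, -⟩ := hparam.isLeast_dist.1
    refine Nat.pos_of_ne_zero ?_
    rintro rfl
    exact hne (Subsingleton.elim _ _)
  have hD := hgen.orthogonal_reversalForm_le hn hfactor hdvd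
  refine ⟨cosetCode 𝒞 ((reversalForm F n).orthogonal 𝒞), ?_,
    hasQuantumDistanceGE_cosetCode hparam.eq_zero_of_support_subset fun S hS =>
      exists_mem_orthogonal_reversalForm_restrict_eq S fun c hc hcS =>
        hparam.eq_zero_of_support_subset (S.map Fin.revPerm.toEmbedding)
          (by rwa [Finset.card_map]) c hc fun i hi => hcS i fun hi' => hi ?_⟩
  · have h1 := LinearMap.BilinForm.finrank_orthogonal (reversalForm_nondegenerate (F := F) (n := n))
      𝒞
    -- `D ≤ 𝒞` gives `n - k ≤ k`, so the truncated exponent `k - (n - k)` equals the integer `2k -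
    -- n`.
    have h2 := Submodule.finrank_mono hD
    have h3 := 𝒞.finrank_le
    rw [Module.finrank_fin_fun, hparam.dim_eq] at h1 h3
    rw [hparam.dim_eq, h1] at h2
    rw [finrank_cosetCode hD, h1, hparam.dim_eq, Nat.cast_pow, ← zpow_natCast]
    congr 1
    omega
  · exact Finset.mem_map.2 ⟨i.rev, hi', by simp⟩
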